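/- Let $R$ be a unital ring and let $\mathcal{B}$ be an additive full subcategory of the category of finitely presented left $R$-modules. Write $\varinjlim\mathcal{B}$ for the class of left $R$-modules that are filtered colimits, in the category of left $R$-modules, of modules from $\mathcal{B}$. Assume that $R\in\varinjlim\mathcal{B}$ and that $R$ is $\mathcal{B}$-coherent, i.e. $\varinjlim\mathcal{B}$ is closed under arbitrary products of left $R$-modules. Let $F\in\varinjlim\mathcal{B}$. Then $F$ has a pure injective envelope, and for every pure injective envelope $\varphi\colon F\to PE(F)$ the map $\varphi$ is injective and both $PE(F)$ and the quotient $PE(F)/\varphi(F)$ belong to $\varinjlim\mathcal{B}$. Here a monomorphism $h\colon M\to N$ is pure if every homomorphism from a finitely presented module to $N/h(M)$ lifts to $N$; a module $E$ is pure injective if every homomorphism $M\to E$ extends along every pure monomorphism $M\to N$; and a pure injective envelope of $F$ is a homomorphism $\varphi\colon F\to P$ with $P$ pure injective such that every homomorphism from $F$ to a pure injective module factors through $\varphi$, and every endomorphism $f$ of $P$ with $f\varphi=\varphi$ is an automorphism. -/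

import Mathlib

universe u

/-- `lim→ B`: the class of modules which are (small) filtered colimits, in the category of left
`R`-modules, of modules from `B`. -/
def LimB {R : Type u} [Ring R] (B : CategoryTheory.ObjectProperty (ModuleCat.{u} R)) :
    CategoryTheory.ObjectProperty (ModuleCat.{u} R) :=
  CategoryTheory.ObjectProperty.ind.{u} B

/-- `R` is `B`-coherent if `lim→ B` is closed under arbitrary (small) products of `R`-modules. -/
def IsBCoherent {R : Type u} [Ring R] (B : CategoryTheory.ObjectProperty (ModuleCat.{u} R)) :
    Prop :=
  ∀ (ι : Type u) (X : ι → ModuleCat.{u} R), (∀ i, LimB B (X i)) →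
    LimB B (ModuleCat.of R (∀ i, X i))

/-- A pure monomorphism: `0 → M → N → N / M → 0` is exact and remains exact under `Hom_R(Q, -)`
for every finitely presented module `Q`. -/
def IsPureMono {R : Type u} [Ring R] {M N : Type u} [AddCommGroup M] [Module R M]
    [AddCommGroup N] [Module R N] (h : M →ₗ[R] N) : Prop :=
  Function.Injective h ∧
    ∀ (Q : Type u) [AddCommGroup Q] [Module R Q], Module.FinitePresentation R Q →
      ∀ g : Q →ₗ[R] (N ⧸ LinearMap.range h),
        ∃ g' : Q →ₗ[R] N, (LinearMap.range h).mkQ ∘ₗ g' = g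

/-- A pure injective module: homomorphisms into `E` extend along all pure monomorphisms. -/
def IsPureInjective (R : Type u) [Ring R] (E : Type u) [AddCommGroup E] [Module R E] : Prop :=
  ∀ (M N : Type u) [AddCommGroup M] [Module R M] [AddCommGroup N] [Module R N]
    (h : M →ₗ[R] N), IsPureMono h → ∀ f : M →ₗ[R] E, ∃ g : N →ₗ[R] E, g ∘ₗ h = f

/-- `φ : F → P` is a pure injective envelope, i.e. an envelope with respect to the class of pure
injective modules: `P` is pure injective, every homomorphism from `F` to a pure injective module
factors through `φ`, and every endomorphism `f` of `P` with `f ∘ φ = φ` is an automorphism. -/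
structure IsPureInjectiveEnvelope {R : Type u} [Ring R] {F P : Type u} [AddCommGroup F]
    [Module R F] [AddCommGroup P] [Module R P] (φ : F →ₗ[R] P) : Prop where
  pureInjective : IsPureInjective R P
  preenvelope : ∀ (E : Type u) [AddCommGroup E] [Module R E], IsPureInjective R E →
    ∀ f : F →ₗ[R] E, ∃ g : P →ₗ[R] E, g ∘ₗ φ = f
  minimal : ∀ f : P →ₗ[R] P, f ∘ₗ φ = φ → Function.Bijective f

/-! Let F** be the bidual of F with respect to characters into ℝ/ℤ. It is a compact Hausdorff
module, hence pure injective (`isPureInjective_of_compactSpace`), and evaluation F → F** is pure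
(`CircleBidual.isPureMono_eval`). Mapping an envelope P to F** and back fixes F, so by minimality P
is a retract of F**, and F → P is pure.

By `limB_iff`, a module is in lim→ B iff each map to it from a finitely presented module factors
through a member of B. This property passes to retracts and pure quotients, so everything reduces to
F** ∈ lim→ B (`limB_circleBidual`). For Q finitely presented, coherence puts F^Hom(Q,F) in lim→ B,
so the canonical map from Q to it factors through some q : Q → W with W in B. Hence every map Q → F
extends along q. Dualizing twice, and using that Hom(Q,F)** → Hom(Q,F**) is onto, every map Q → F**
extends along q too.

An envelope exists as the image of a minimal idempotent in the compact monoid of endomorphisms of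
F** fixing F. -/

open CategoryTheory Limits

/-! ### Finitely presented modules as finitely presentable objects -/

section FinitelyPresentable

variable {R : Type u} [Ring R]

lemma Module.FinitePresentation.of_retract {M N : Type*} [AddCommGroup M] [Module R M]
    [AddCommGroup N] [Module R N] [Module.FinitePresentation R M] (i : N →ₗ[R] M)
    (r : M →ₗ[R] N) (h : r ∘ₗ i = LinearMap.id) : Module.FinitePresentation R N := by
  have hri (x : N) : r (i x) = x := LinearMap.congr_fun h x
  refine Module.finitePresentation_of_surjective r (fun x ↦ ⟨i x, hri x⟩) ?_
  have : LinearMap.ker r = LinearMap.range (LinearMap.id - i ∘ₗ r) := by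
    ext x
    constructor
    · intro hx
      exact ⟨x, by simp [LinearMap.mem_ker.1 hx]⟩
    · rintro ⟨y, rfl⟩
      simp [hri]
  rw [this, LinearMap.range_eq_map]
  exact Submodule.FG.map _ (Module.Finite.fg_top)

namespace ModuleCat

attribute [local instance] Cardinal.fact_isRegular_aleph0

lemma finitePresentation_of_isColimit {J : Type u} [SmallCategory J] [FinCategory J]
    {D : J ⥤ ModuleCat.{u} R} {c : Cocone D} (hc : IsColimit c)
    (hD : ∀ j, Module.FinitePresentation R (D.obj j)) : Module.FinitePresentation R c.pt := by
  classical
  -- The colimit as a finite sum modulo one finitely generated family of relations per arrow; being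
  -- a retract of this quotient suffices.
  let K : Submodule R (∀ j, D.obj j) := ⨆ f : Arrow J,
    LinearMap.range (LinearMap.single R (fun j ↦ D.obj j) f.right ∘ₗ (D.map f.hom).hom -
      LinearMap.single R (fun j ↦ D.obj j) f.left)
  have : Finite (Arrow J) := inferInstance
  have hK : K.FG := Submodule.fg_iSup _ fun f ↦ by
    rw [LinearMap.range_eq_map]
    exact Submodule.FG.map _ (Module.Finite.fg_top)
  have := Module.finitePresentation_of_surjective K.mkQ K.mkQ_surjective (by simpa using hK)
  let r : (∀ j, D.obj j) →ₗ[R] c.pt := LinearMap.lsum R _ ℕ fun j ↦ (c.ι.app j).hom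
  have hr (j : J) (x : D.obj j) : r (LinearMap.single R (fun j ↦ D.obj j) j x) =
      (c.ι.app j).hom x := by
    simp only [r, LinearMap.lsum_apply, LinearMap.sum_apply]
    rw [Finset.sum_eq_single j]
    · simp
    · intro i _ hij
      simp [hij]
    · simp
  have hKr : K ≤ LinearMap.ker r := by
    refine iSup_le fun f ↦ ?_
    rintro _ ⟨x, rfl⟩
    rw [LinearMap.mem_ker, LinearMap.sub_apply, map_sub, LinearMap.comp_apply, hr, hr,
      ← c.w f.hom]
    simp
  let s : Cocone D :=
    { pt := ModuleCat.of R (_ ⧸ K)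
      ι :=
        { app j := ModuleCat.ofHom (K.mkQ ∘ₗ LinearMap.single R (fun j ↦ D.obj j) j)
          naturality i j f := by
            ext x
            simp only [ModuleCat.hom_comp, LinearMap.comp_apply, ModuleCat.hom_ofHom,
              Functor.const_obj_map]
            refine (Submodule.Quotient.eq K).2 ?_
            exact Submodule.mem_iSup_of_mem (Arrow.mk f) ⟨x, rfl⟩ } }
  refine Module.FinitePresentation.of_retract (hc.desc s).hom (K.liftQ r hKr) ?_
  have : hc.desc s ≫ ModuleCat.ofHom (K.liftQ r hKr) = 𝟙 c.pt := by
    refine hc.hom_ext fun j ↦ ?_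
    rw [hc.fac_assoc, Category.comp_id]
    ext x
    exact hr j x
  exact congrArg ModuleCat.Hom.hom this

lemma isFinitelyPresentable_self : IsFinitelyPresentable.{u} (ModuleCat.of R R) := by
  rw [isFinitelyPresentable_iff_preservesFilteredColimits]
  let e : coyoneda.obj (Opposite.op (ModuleCat.of R R)) ≅ forget (ModuleCat.{u} R) :=
    NatIso.ofComponents (fun M ↦ Equiv.toIso
      { toFun f := f.hom (1 : R)
        invFun x := ModuleCat.ofHom (LinearMap.toSpanSingleton R M x)
        left_inv f := by
          refine ModuleCat.hom_ext (LinearMap.ext_ring ?_)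
          simp
        right_inv x := by simp }) (fun f ↦ by ext x; rfl)
  exact ⟨fun _ _ _ ↦ ⟨fun {_} ↦ preservesColimit_of_natIso _ e.symm⟩⟩

lemma isStrongGenerator_singleton_self :
    (ObjectProperty.singleton (ModuleCat.of R R)).IsStrongGenerator := by
  rw [ObjectProperty.isStrongGenerator_iff]
  refine ⟨?_, fun X Y i _ hi ↦ ?_⟩
  · intro X Y f g h
    ext x
    have := h (ModuleCat.of R R) (.mk ⟨⟩) (ModuleCat.ofHom (LinearMap.toSpanSingleton R X x))
    simpa using congrArg (fun k ↦ k.hom (1 : R)) this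
  · have : Epi i := by
      rw [ModuleCat.epi_iff_surjective]
      intro y
      obtain ⟨f, hf⟩ := hi (ModuleCat.of R R) (.mk ⟨⟩) (ModuleCat.ofHom (LinearMap.toSpanSingleton R Y y))
      exact ⟨f.hom (1 : R), by simpa using congrArg (fun k ↦ k.hom (1 : R)) hf⟩
    exact isIso_of_mono_of_epi i

lemma singleton_self_le_isCardinalPresentable :
    ObjectProperty.singleton (ModuleCat.of R R) ≤
      isCardinalPresentable (ModuleCat.{u} R) Cardinal.aleph0.{u} := by
  rintro _ ⟨⟩
  exact isFinitelyPresentable_self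

instance isFinitelyAccessibleCategory : IsFinitelyAccessibleCategory.{u} (ModuleCat.{u} R) := by
  have : IsCardinalLocallyPresentable (ModuleCat.{u} R) Cardinal.aleph0.{u} :=
    (IsCardinalLocallyPresentable.iff_exists_isStrongGenerator _ _).2
      ⟨_, inferInstance, isStrongGenerator_singleton_self, singleton_self_le_isCardinalPresentable⟩
  infer_instance

lemma isFinitelyPresentable_iff (M : ModuleCat.{u} R) :
    IsFinitelyPresentable.{u} M ↔ Module.FinitePresentation R M := by
  constructor
  · intro h
    let Q : ObjectProperty (ModuleCat.{u} R) := fun X ↦ Module.FinitePresentation R X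
    have : Q.IsClosedUnderIsomorphisms := ⟨fun e h ↦
      have : Module.FinitePresentation R _ := h
      .of_equiv e.toLinearEquiv⟩
    -- Since R is a finitely presentable strong generator, the finitely presentable objects are the
    -- closure of R under finite colimits.
    have hle : (ObjectProperty.singleton (ModuleCat.of R R)).colimitsCardinalClosure
        Cardinal.aleph0.{u} ≤ Q := by
      refine ObjectProperty.colimitsCardinalClosure_le _ _ (fun J _ hJ ↦ .mk' ?_) ?_
      · rintro X ⟨D, hD⟩
        rw [hasCardinalLT_aleph0_iff] at hJ
        have := (Arrow.finite_iff J).1 hJ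
        have : FinCategory J := Classical.choice this
        exact finitePresentation_of_isColimit (colimit.isColimit D) hD
      · rintro _ ⟨⟩
        exact inferInstanceAs (Module.FinitePresentation R R)
    have hM : isCardinalPresentable (ModuleCat.{u} R) Cardinal.aleph0.{u} M := h
    have heq := CategoryTheory.IsStrongGenerator.colimitsCardinalClosure_eq_isCardinalPresentable
      (isStrongGenerator_singleton_self (R := R)) singleton_self_le_isCardinalPresentable
    rw [heq] at hM
    exact hle _ hM
  · intro h
    obtain ⟨n, m, f, g, hf, hfg⟩ := Module.FinitePresentation.exists_fin' R M
    let P := isCardinalPresentable (ModuleCat.{u} R) Cardinal.aleph0.{u}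
    have hfree (n : ℕ) : P (ModuleCat.of R (Fin n → R)) := by
      have : P.IsClosedUnderColimitsOfShape (Discrete (Fin n)) :=
        isClosedUnderColimitsOfShape_isCardinalPresentable _ (by
          simp only [hasCardinalLT_aleph0_iff]
          infer_instance)
      refine P.prop_of_iso (ModuleCat.biproductIsoPi fun _ : Fin n ↦ ModuleCat.of R R) ?_
      refine P.prop_of_iso (biproduct.isoCoproduct _).symm ?_
      exact P.prop_colimit _ fun _ ↦ isFinitelyPresentable_self
    have : P.IsClosedUnderColimitsOfShape WalkingParallelPair :=
        isClosedUnderColimitsOfShape_isCardinalPresentable _ (by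
          simp only [hasCardinalLT_aleph0_iff]
          infer_instance)
    have hcok : P (ModuleCat.of R ((Fin n → R) ⧸ LinearMap.range g)) := by
      refine P.prop_of_isColimit (ModuleCat.cokernelIsColimit (ModuleCat.ofHom g)) ?_
      rintro (_ | _)
      · exact hfree m
      · exact hfree n
    refine P.prop_of_iso (LinearEquiv.toModuleIso ?_) hcok
    exact (Submodule.quotEquivOfEq _ _ hfg.linearMap_ker_eq.symm).trans
      (f.quotKerEquivOfSurjective hf)

end ModuleCat

end FinitelyPresentable

/-- Holds because the module category is finitely accessible and B consists of finitely presentable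
objects. Filtered colimits do not appear after this point. -/
lemma limB_iff {R : Type u} [Ring R] {B : ObjectProperty (ModuleCat.{u} R)}
    (hfp : ∀ M : ModuleCat.{u} R, B M → Module.FinitePresentation R M) (X : ModuleCat.{u} R) :
    LimB B X ↔ ∀ (Q : Type u) [AddCommGroup Q] [Module R Q], Module.FinitePresentation R Q →
      ∀ f : Q →ₗ[R] X, ∃ (W : ModuleCat.{u} R) (p : Q →ₗ[R] W) (v : W →ₗ[R] X),
        B W ∧ v ∘ₗ p = f := by
  rw [LimB, ObjectProperty.ind_iff_exists
    (fun M hM ↦ (ModuleCat.isFinitelyPresentable_iff M).2 (hfp M hM))]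
  constructor
  · intro h Q _ _ hQ f
    have : IsFinitelyPresentable.{u} (ModuleCat.of R Q) :=
      (ModuleCat.isFinitelyPresentable_iff _).2 hQ
    obtain ⟨W, p, v, hpv, hW⟩ := h (ModuleCat.ofHom f)
    exact ⟨W, p.hom, v.hom, hW, congrArg ModuleCat.Hom.hom hpv⟩
  · intro h Z g hZ
    obtain ⟨W, p, v, hW, hpv⟩ := h Z ((ModuleCat.isFinitelyPresentable_iff Z).1 hZ) g.hom
    exact ⟨W, ModuleCat.ofHom p, ModuleCat.ofHom v, ModuleCat.hom_ext hpv, hW⟩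

lemma LinearMap.exists_comp_eq_of_surjective {R M N P : Type*} [Ring R] [AddCommGroup M]
    [Module R M] [AddCommGroup N] [Module R N] [AddCommGroup P] [Module R P] {p : M →ₗ[R] N}
    (hp : Function.Surjective p) (f : M →ₗ[R] P) (h : LinearMap.ker p ≤ LinearMap.ker f) :
    ∃ g : N →ₗ[R] P, g ∘ₗ p = f := by
  refine ⟨(LinearMap.ker p).liftQ f h ∘ₗ (p.quotKerEquivOfSurjective hp).symm.toLinearMap,
    LinearMap.ext fun y ↦ ?_⟩
  have hy : (p.quotKerEquivOfSurjective hp).symm (p y) = (LinearMap.ker p).mkQ y :=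
    (LinearEquiv.symm_apply_eq _).2 rfl
  exact congrArg ((LinearMap.ker p).liftQ f h) hy

/-! ### Characters with values in ℝ/ℤ -/

section CircleCharacters

lemma exists_circle_extension {A B : Type*} [AddCommGroup A] [AddCommGroup B] (i : A →+ B)
    (hi : Function.Injective i) (χ : A →+ UnitAddCircle) :
    ∃ χ' : B →+ UnitAddCircle, χ'.comp i = χ :=
  (Module.Baer.of_divisible UnitAddCircle).extension_property_addMonoidHom i hi χ

lemma exists_circle_extension_of_ker_le {A B : Type*} [AddCommGroup A] [AddCommGroup B]
    (i : A →+ B) (χ : A →+ UnitAddCircle) (h : i.ker ≤ χ.ker) :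
    ∃ χ' : B →+ UnitAddCircle, χ'.comp i = χ := by
  obtain ⟨χ', h'⟩ := exists_circle_extension (QuotientAddGroup.kerLift i)
    (QuotientAddGroup.kerLift_injective i) (QuotientAddGroup.lift i.ker χ h)
  refine ⟨χ', ?_⟩
  ext x
  exact DFunLike.congr_fun h' (QuotientAddGroup.mk x)

/-- Characters into ℚ/ℤ separate points, and ℚ/ℤ embeds in ℝ/ℤ. The real circle is preferred for its
compactness. -/
lemma exists_circle_character_ne_zero {A : Type*} [AddCommGroup A] {a : A} (ha : a ≠ 0) :
    ∃ χ : A →+ UnitAddCircle, χ a ≠ 0 := by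
  obtain ⟨c, hc⟩ := CharacterModule.exists_character_apply_ne_zero_of_ne_zero ha
  let j : AddCircle (1 : ℚ) →+ UnitAddCircle :=
    QuotientAddGroup.map _ (AddSubgroup.zmultiples (1 : ℝ)) (Rat.castHom ℝ).toAddMonoidHom (by
      rintro _ ⟨n, rfl⟩
      exact ⟨n, by simp⟩)
  refine ⟨j.comp c, fun h ↦ hc ?_⟩
  have hj : Function.Injective j := by
    refine (injective_iff_map_eq_zero j).2 fun x hx ↦ ?_
    obtain ⟨q, rfl⟩ := QuotientAddGroup.mk_surjective x
    have hx' : ((q : ℝ) : UnitAddCircle) = 0 := hx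
    obtain ⟨n, hn⟩ := (AddCircle.coe_eq_zero_iff _).1 hx'
    refine (AddCircle.coe_eq_zero_iff (1 : ℚ)).2 ⟨n, ?_⟩
    rw [zsmul_one] at hn ⊢
    exact_mod_cast hn
  exact hj (h.trans (map_zero j).symm)

lemma mem_range_of_forall_circle_character {A B : Type*} [AddCommGroup A] [AddCommGroup B]
    (i : A →+ B) (b : B) (h : ∀ χ : B →+ UnitAddCircle, χ.comp i = 0 → χ b = 0) :
    b ∈ i.range := by
  by_contra hb
  obtain ⟨χ, hχ⟩ := exists_circle_character_ne_zero
    (a := QuotientAddGroup.mk' i.range b) (by simpa using hb)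
  refine hχ (h (χ.comp (QuotientAddGroup.mk' i.range)) ?_)
  ext x
  have : QuotientAddGroup.mk' i.range (i x) = 0 := (QuotientAddGroup.eq_zero_iff _).2 ⟨x, rfl⟩
  exact (congrArg χ this).trans (map_zero χ)

end CircleCharacters

/-- The bidual of an abelian group `M`: the characters, with values in the circle `ℝ / ℤ`, of the
group of characters of `M`. -/
def CircleBidual (M : Type*) [AddCommGroup M] : Type _ :=
  (M →+ UnitAddCircle) →+ UnitAddCircle

/-! ### The bidual as a compact module, and its comparison with Hom -/

namespace CircleBidual

section Basic

variable {R : Type*} [Ring R] {M : Type*} [AddCommGroup M] [Module R M]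

instance : AddCommGroup (CircleBidual M) :=
  inferInstanceAs (AddCommGroup ((M →+ UnitAddCircle) →+ UnitAddCircle))

instance : FunLike (CircleBidual M) (M →+ UnitAddCircle) UnitAddCircle :=
  inferInstanceAs (FunLike ((M →+ UnitAddCircle) →+ UnitAddCircle) _ _)

instance : AddMonoidHomClass (CircleBidual M) (M →+ UnitAddCircle) UnitAddCircle :=
  inferInstanceAs (AddMonoidHomClass ((M →+ UnitAddCircle) →+ UnitAddCircle) _ _)

@[ext] lemma ext {Y Z : CircleBidual M} (h : ∀ χ, Y χ = Z χ) : Y = Z :=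
  DFunLike.ext _ _ h

@[simp] lemma add_apply (Y Z : CircleBidual M) (χ : M →+ UnitAddCircle) :
    (Y + Z) χ = Y χ + Z χ := rfl

@[simp] lemma zero_apply (χ : M →+ UnitAddCircle) : (0 : CircleBidual M) χ = 0 := rfl

instance : SMul R (CircleBidual M) where
  smul r Y := AddMonoidHom.comp (show (M →+ UnitAddCircle) →+ UnitAddCircle from Y)
    (AddMonoidHom.compHom' (DistribSMul.toAddMonoidHom M r))

lemma smul_apply (r : R) (Y : CircleBidual M) (χ : M →+ UnitAddCircle) :
    (r • Y) χ = Y (χ.comp (DistribSMul.toAddMonoidHom M r)) := rfl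

instance : Module R (CircleBidual M) where
  one_smul Y := by
    ext χ
    rw [smul_apply]
    congr 1
    ext
    simp
  mul_smul r s Y := by
    ext χ
    simp only [smul_apply]
    congr 1
    ext
    simp [mul_smul]
  smul_zero r := by
    ext χ
    simp [smul_apply]
  smul_add r Y Z := by
    ext χ
    simp [smul_apply]
  add_smul r s Y := by
    ext χ
    rw [add_apply]
    simp only [smul_apply]
    rw [← map_add]
    congr 1
    ext
    simp [add_smul]
  zero_smul Y := by
    ext χ
    rw [smul_apply, zero_apply, ← map_zero Y]
    congr 1
    ext
    simp

variable (R M) in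
/-- The evaluation map from a module to its bidual. -/
def eval : M →ₗ[R] CircleBidual M where
  toFun m := AddMonoidHom.eval m
  map_add' m n := by
    ext χ
    exact map_add χ m n
  map_smul' r m := rfl

@[simp] lemma eval_apply (m : M) (χ : M →+ UnitAddCircle) : eval R M m χ = χ m := rfl

/-- The bidual has the topology of pointwise convergence. -/
instance : TopologicalSpace (CircleBidual M) :=
  .induced (fun Y χ ↦ Y χ) Pi.topologicalSpace

lemma continuous_apply (χ : M →+ UnitAddCircle) : Continuous fun Y : CircleBidual M ↦ Y χ :=
  (_root_.continuous_apply χ).comp continuous_induced_dom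

lemma continuous_iff {X : Type*} [TopologicalSpace X] {f : X → CircleBidual M} :
    Continuous f ↔ ∀ χ, Continuous fun x ↦ f x χ :=
  continuous_induced_rng.trans continuous_pi_iff

/-- Additivity is a closed condition in a product of circles, so the bidual inherits compactness. -/
lemma isClosedEmbedding_coe :
    Topology.IsClosedEmbedding (fun (Y : CircleBidual M) (χ : M →+ UnitAddCircle) ↦ Y χ) where
  eq_induced := rfl
  injective _ _ h := ext fun χ ↦ congrFun h χ
  isClosed_range := by
    have : Set.range (fun (Y : CircleBidual M) (χ : M →+ UnitAddCircle) ↦ Y χ) =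
        ⋂ (χ : M →+ UnitAddCircle) (ψ : M →+ UnitAddCircle), {f | f (χ + ψ) = f χ + f ψ} := by
      ext f
      simp only [Set.mem_range, Set.mem_iInter]
      constructor
      · rintro ⟨Y, rfl⟩ χ ψ
        exact map_add Y χ ψ
      · intro h
        exact ⟨AddMonoidHom.mk' f h, rfl⟩
    rw [this]
    exact isClosed_iInter fun χ ↦ isClosed_iInter fun ψ ↦
      isClosed_eq (by fun_prop) (by fun_prop)

instance : CompactSpace (CircleBidual M) := isClosedEmbedding_coe.compactSpace

instance : T2Space (CircleBidual M) := isClosedEmbedding_coe.isEmbedding.t2Space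

instance : ContinuousAdd (CircleBidual M) where
  continuous_add := continuous_iff.2 fun χ ↦
    ((continuous_apply χ).comp continuous_fst).add ((continuous_apply χ).comp continuous_snd)

instance : ContinuousConstSMul R (CircleBidual M) where
  continuous_const_smul _ := continuous_iff.2 fun _ ↦ continuous_apply _

end Basic

section Hom

variable {R : Type*} [Ring R] (M : Type*) [AddCommGroup M] [Module R M]
  {Q Q' : Type*} [AddCommGroup Q] [Module R Q] [AddCommGroup Q'] [Module R Q']

/-- Evaluation of linear maps at a point. -/
def evalHom (q : Q) : (Q →ₗ[R] M) →+ M where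
  toFun f := f q
  map_zero' := rfl
  map_add' _ _ := rfl

/-- Precomposition with a linear map. -/
def precomp (p : Q →ₗ[R] Q') : (Q' →ₗ[R] M) →+ (Q →ₗ[R] M) where
  toFun f := f ∘ₗ p
  map_zero' := rfl
  map_add' _ _ := rfl

/-- The canonical map from the bidual of `Hom(Q, M)` to `Hom(Q, M**)`. -/
def homComparison (ξ : CircleBidual (Q →ₗ[R] M)) : Q →ₗ[R] CircleBidual M where
  toFun q := AddMonoidHom.comp (show ((Q →ₗ[R] M) →+ UnitAddCircle) →+ UnitAddCircle from ξ)
    (AddMonoidHom.compHom' (evalHom M q))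
  map_add' q q' := by
    ext χ
    refine (congrArg ξ ?_).trans (map_add ξ _ _)
    ext f
    simp [evalHom]
  map_smul' r q := by
    ext χ
    refine congrArg ξ ?_
    ext f
    simp [evalHom]

lemma homComparison_apply (ξ : CircleBidual (Q →ₗ[R] M)) (q : Q) (χ : M →+ UnitAddCircle) :
    homComparison M ξ q χ = ξ (χ.comp (evalHom M q)) := rfl

/-- Functoriality of the bidual. -/
def map {A B : Type*} [AddCommGroup A] [AddCommGroup B] (i : A →+ B) (ξ : CircleBidual A) :
    CircleBidual B :=
  AddMonoidHom.comp (show (A →+ UnitAddCircle) →+ UnitAddCircle from ξ) (AddMonoidHom.compHom' i)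

lemma map_apply {A B : Type*} [AddCommGroup A] [AddCommGroup B] (i : A →+ B)
    (ξ : CircleBidual A) (χ : B →+ UnitAddCircle) : map i ξ χ = ξ (χ.comp i) := rfl

lemma map_surjective {A B : Type*} [AddCommGroup A] [AddCommGroup B] {i : A →+ B}
    (hi : Function.Surjective i) : Function.Surjective (map i) := by
  intro ξ
  obtain ⟨η, hη⟩ := exists_circle_extension
    (AddMonoidHom.compHom' i : (B →+ UnitAddCircle) →+ (A →+ UnitAddCircle)) (fun χ ψ h ↦ by
      ext b
      obtain ⟨a, rfl⟩ := hi b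
      exact DFunLike.congr_fun h a) ξ
  exact ⟨η, hη⟩

lemma exists_map_eq_of_exact {A B C : Type*} [AddCommGroup A] [AddCommGroup B] [AddCommGroup C]
    {i : A →+ B} {j : B →+ C} (h : j.ker ≤ i.range) {ξ : CircleBidual B} (hξ : map j ξ = 0) :
    ∃ η : CircleBidual A, map i η = ξ := by
  refine exists_circle_extension_of_ker_le
    (AddMonoidHom.compHom' i : (B →+ UnitAddCircle) →+ (A →+ UnitAddCircle)) ξ fun χ hχ ↦ ?_
  obtain ⟨ψ, rfl⟩ := exists_circle_extension_of_ker_le j χ fun b hb ↦ by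
    obtain ⟨a, rfl⟩ := h hb
    exact DFunLike.congr_fun (AddMonoidHom.mem_ker.1 hχ) a
  exact DFunLike.congr_fun hξ ψ

lemma homComparison_map_precomp (p : Q →ₗ[R] Q') (ξ : CircleBidual (Q' →ₗ[R] M)) :
    homComparison M (map (precomp M p) ξ) = homComparison M ξ ∘ₗ p := rfl

lemma homComparison_eval (f : Q →ₗ[R] M) :
    homComparison M (eval ℤ (Q →ₗ[R] M) f) = eval R M ∘ₗ f := rfl

/-- The linear map from a free module which sends a basis vector to a given element. -/
def single {ι : Type*} [DecidableEq ι] (i : ι) : M →+ ((ι → R) →ₗ[R] M) where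
  toFun m := LinearMap.toSpanSingleton R M m ∘ₗ LinearMap.proj i
  map_zero' := by
    ext
    simp
  map_add' m n := by
    ext
    simp

lemma evalHom_single {ι : Type*} [DecidableEq ι] (i : ι) (m : M) (x : ι → R) :
    evalHom M x (single M i m) = x i • m := rfl

lemma eq_sum_single {ι : Type*} [DecidableEq ι] [Fintype ι] (f : (ι → R) →ₗ[R] M) :
    f = ∑ i, single M i (evalHom M (Pi.single i 1) f) := by
  refine LinearMap.pi_ext' fun i ↦ LinearMap.ext_ring ?_
  simp only [LinearMap.comp_apply, LinearMap.single_apply, LinearMap.sum_apply]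
  rw [Finset.sum_eq_single i]
  · simp [single, evalHom]
  · intro j _ hj
    simp [single, hj]
  · simp

lemma eq_sum_comp_single {ι : Type*} [DecidableEq ι] [Fintype ι]
    (χ : ((ι → R) →ₗ[R] M) →+ UnitAddCircle) :
    χ = ∑ i, (χ.comp (single M i)).comp (evalHom M (Pi.single i (1 : R))) := by
  ext f
  conv_lhs => rw [eq_sum_single M f, map_sum]
  simp

lemma homComparison_free_bijective (ι : Type*) [Fintype ι] :
    Function.Bijective (homComparison (R := R) (Q := ι → R) M) := by
  classical
  constructor
  · intro ξ η h
    ext χ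
    rw [eq_sum_comp_single M χ, map_sum, map_sum]
    refine Finset.sum_congr rfl fun i _ ↦ ?_
    exact DFunLike.congr_fun (LinearMap.congr_fun h (Pi.single i 1)) (χ.comp (single M i))
  · intro c
    let ξ : CircleBidual ((ι → R) →ₗ[R] M) := ∑ i, map (single M i) (c (Pi.single i 1))
    refine ⟨ξ, LinearMap.pi_ext' fun i ↦ LinearMap.ext_ring ?_⟩
    ext χ
    have hξ (ψ : ((ι → R) →ₗ[R] M) →+ UnitAddCircle) :
        ξ ψ = ∑ j, c (Pi.single j 1) (ψ.comp (single M j)) := by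
      let ev : CircleBidual ((ι → R) →ₗ[R] M) →+ UnitAddCircle :=
        AddMonoidHom.mk' (fun Y ↦ Y ψ) fun _ _ ↦ rfl
      exact map_sum ev _ _
    rw [LinearMap.comp_apply, LinearMap.comp_apply, homComparison_apply, hξ,
      Finset.sum_eq_single i]
    · refine congrArg (c (Pi.single i 1)) ?_
      ext m
      simp [evalHom_single]
    · intro j _ hj
      rw [← map_zero (c (Pi.single j 1))]
      refine congrArg (c (Pi.single j 1)) ?_
      ext m
      simp [evalHom_single, hj]
    · simp

/-- Both Hom(-,M)** and Hom(-,M**) are left exact and agree on finite free modules; a diagram chase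
along a finite presentation of Q gives the result. -/
lemma homComparison_surjective [Module.FinitePresentation R Q] :
    Function.Surjective (homComparison (R := R) (Q := Q) M) := by
  obtain ⟨n, m, p, a, hp, hpa⟩ := Module.FinitePresentation.exists_fin' R Q
  intro x
  obtain ⟨ξ, hξ⟩ := (homComparison_free_bijective M (Fin n)).2 (x ∘ₗ p)
  obtain ⟨η, rfl⟩ := exists_map_eq_of_exact (i := precomp M p) (j := precomp M a) (ξ := ξ)
    (fun f hf ↦ LinearMap.exists_comp_eq_of_surjective hp f (by
      rw [hpa.linearMap_ker_eq]
      rintro _ ⟨y, rfl⟩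
      exact LinearMap.congr_fun (AddMonoidHom.mem_ker.1 hf) y))
    (by
      refine (homComparison_free_bijective M (Fin m)).1 ?_
      rw [homComparison_map_precomp, hξ, LinearMap.comp_assoc, hpa.linearMap_comp_eq_zero,
        LinearMap.comp_zero]
      rfl)
  refine ⟨η, LinearMap.ext fun q ↦ ?_⟩
  obtain ⟨y, rfl⟩ := hp q
  exact LinearMap.congr_fun hξ y

/-- If every map `Q → M` extends along `q : Q → Q'`, then so does every map `Q → M**`. -/
lemma exists_extension [Module.FinitePresentation R Q] (q : Q →ₗ[R] Q')
    (h : ∀ f : Q →ₗ[R] M, ∃ g : Q' →ₗ[R] M, g ∘ₗ q = f) (x : Q →ₗ[R] CircleBidual M) :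
    ∃ y : Q' →ₗ[R] CircleBidual M, y ∘ₗ q = x := by
  obtain ⟨ξ, rfl⟩ := homComparison_surjective M x
  obtain ⟨η, rfl⟩ := map_surjective (i := precomp M q) h ξ
  exact ⟨homComparison M η, rfl⟩

/-- Finite systems of linear equations with constants in `M` which are solvable in `M**` are
solvable in `M`. -/
lemma exists_solution {ι κ : Type*} [Fintype ι] [Fintype κ] (a : (κ → R) →ₗ[R] (ι → R))
    (m : (κ → R) →ₗ[R] M) (c : (ι → R) →ₗ[R] CircleBidual M) (h : c ∘ₗ a = eval R M ∘ₗ m) :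
    ∃ d : (ι → R) →ₗ[R] M, d ∘ₗ a = m := by
  obtain ⟨ξ, rfl⟩ := (homComparison_free_bijective M ι).2 c
  rw [← homComparison_map_precomp, ← homComparison_eval] at h
  have h' := (homComparison_free_bijective M κ).1 h
  -- Evaluation at `m` comes from the bidual of Hom(R^ι, M), so it kills every character vanishing
  -- on the image of `precomp M a`.
  refine mem_range_of_forall_circle_character (precomp M a) m fun χ hχ ↦ ?_
  have := DFunLike.congr_fun h' χ
  rw [map_apply, hχ, eval_apply] at this
  rw [← this]
  exact map_zero ξ

end Hom

end CircleBidual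

/-! ### Purity and pure injectivity -/

section Purity

variable {R : Type u} [Ring R]

lemma LinearMap.exists_comp_eq_of_forall_mem_range {M N P : Type*} [AddCommGroup M] [Module R M]
    [AddCommGroup N] [Module R N] [AddCommGroup P] [Module R P] [Module.Projective R P]
    (h : M →ₗ[R] N) (f : P →ₗ[R] N) (hf : ∀ x, f x ∈ LinearMap.range h) :
    ∃ d : P →ₗ[R] M, h ∘ₗ d = f := by
  obtain ⟨d, hd⟩ := Module.projective_lifting_property h.rangeRestrict
    (f.codRestrict (LinearMap.range h) hf) h.surjective_rangeRestrict
  refine ⟨d, LinearMap.ext fun x ↦ ?_⟩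
  exact congrArg Subtype.val (LinearMap.congr_fun hd x)

/-- Lift `g` to `c` on the generators of Q. On the relations `c` takes values in M; a solution `d`
in M of this system corrects `c` to a map that descends to Q. -/
lemma isPureMono_of_exists_solution {M N : Type u} [AddCommGroup M] [Module R M]
    [AddCommGroup N] [Module R N] (h : M →ₗ[R] N) (hinj : Function.Injective h)
    (H : ∀ (n k : ℕ) (a : (Fin k → R) →ₗ[R] (Fin n → R)) (m : (Fin k → R) →ₗ[R] M)
      (c : (Fin n → R) →ₗ[R] N), c ∘ₗ a = h ∘ₗ m → ∃ d : (Fin n → R) →ₗ[R] M, d ∘ₗ a = m) :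
    IsPureMono h := by
  refine ⟨hinj, fun Q _ _ hQ g ↦ ?_⟩
  obtain ⟨n, k, p, a, hp, hpa⟩ := Module.FinitePresentation.exists_fin' R Q
  obtain ⟨c, hc⟩ := Module.projective_lifting_property (LinearMap.range h).mkQ (g ∘ₗ p)
    (LinearMap.range h).mkQ_surjective
  obtain ⟨m, hm⟩ := LinearMap.exists_comp_eq_of_forall_mem_range h (c ∘ₗ a) (fun x ↦ by
    rw [← (LinearMap.range h).ker_mkQ, LinearMap.mem_ker, ← LinearMap.comp_apply,
      ← LinearMap.comp_assoc, hc, LinearMap.comp_assoc, hpa.linearMap_comp_eq_zero]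
    simp)
  obtain ⟨d, hd⟩ := H n k a m c hm.symm
  obtain ⟨g', hg'⟩ := LinearMap.exists_comp_eq_of_surjective hp (c - h ∘ₗ d) (by
    rw [hpa.linearMap_ker_eq]
    rintro _ ⟨y, rfl⟩
    rw [LinearMap.mem_ker, ← LinearMap.comp_apply, LinearMap.sub_comp, LinearMap.comp_assoc, hd,
      hm, sub_self, LinearMap.zero_apply])
  refine ⟨g', LinearMap.ext fun q ↦ ?_⟩
  obtain ⟨y, rfl⟩ := hp q
  have h1 : g' (p y) = c y - h (d y) := LinearMap.congr_fun hg' y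
  have h2 : (LinearMap.range h).mkQ (c y) = g (p y) := LinearMap.congr_fun hc y
  have h3 : (LinearMap.range h).mkQ (h (d y)) = 0 :=
    (Submodule.Quotient.mk_eq_zero _).2 ⟨_, rfl⟩
  rw [LinearMap.comp_apply, h1, map_sub, h2, h3, sub_zero]

/-- Only finitely many basis vectors occur in `s`. Killing `s` in their span gives a finitely
presented module whose map to N/M lifts to N; subtracting the lift from `c` pushes `c` into M
without changing it on `s`. -/
lemma IsPureMono.exists_local_retraction {M N : Type u} [AddCommGroup M] [Module R M]
    [AddCommGroup N] [Module R N] {h : M →ₗ[R] N} (hh : IsPureMono h) {α : Type u}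
    (c : (α →₀ R) →ₗ[R] N) (s : Finset (α →₀ R)) (hs : ∀ x ∈ s, c x ∈ LinearMap.range h) :
    ∃ d : (α →₀ R) →ₗ[R] M, ∀ x ∈ s, h (d x) = c x := by
  classical
  let S : Finset α := s.biUnion Finsupp.support
  let ρ : (α →₀ R) →ₗ[R] (S →₀ R) := Finsupp.lsubtypeDomain (S : Set α)
  let i : (S →₀ R) →ₗ[R] (α →₀ R) := Finsupp.lmapDomain R R Subtype.val
  have hi (x : α →₀ R) (hx : x ∈ s) : i (ρ x) = x := by
    ext a
    by_cases ha : a ∈ S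
    · exact Finsupp.mapDomain_apply Subtype.val_injective (ρ x) ⟨a, ha⟩
    · have h0 : x a = 0 := by
        by_contra h0
        exact ha (Finset.mem_biUnion.2 ⟨x, hx, Finsupp.mem_support_iff.2 h0⟩)
      rw [h0]
      exact Finsupp.mapDomain_of_notMem_range _ _ (by simpa using ha)
  let K : Submodule R (S →₀ R) := Submodule.span R (s.image ρ : Finset (S →₀ R))
  have : Module.FinitePresentation R ((S →₀ R) ⧸ K) :=
    Module.finitePresentation_of_surjective K.mkQ K.mkQ_surjective
      (by simpa using ⟨s.image ρ, rfl⟩)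
  have hK : K ≤ LinearMap.ker ((LinearMap.range h).mkQ ∘ₗ c ∘ₗ i) := by
    refine Submodule.span_le.2 fun y hy ↦ ?_
    obtain ⟨x, hx, rfl⟩ := Finset.mem_image.1 hy
    refine (Submodule.Quotient.mk_eq_zero _).2 ?_
    rw [LinearMap.comp_apply, hi x hx]
    exact hs x hx
  obtain ⟨t, ht⟩ := hh.2 _ this (K.liftQ _ hK)
  obtain ⟨d, hd⟩ := LinearMap.exists_comp_eq_of_forall_mem_range h (c ∘ₗ i - t ∘ₗ K.mkQ)
    (fun x ↦ by
      rw [← (LinearMap.range h).ker_mkQ, LinearMap.mem_ker, LinearMap.sub_apply, map_sub,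
        sub_eq_zero]
      exact (LinearMap.congr_fun ht (K.mkQ x)).symm)
  refine ⟨d ∘ₗ ρ, fun x hx ↦ ?_⟩
  have h1 : h (d (ρ x)) = c (i (ρ x)) - t (K.mkQ (ρ x)) := LinearMap.congr_fun hd (ρ x)
  have h2 : K.mkQ (ρ x) = 0 :=
    (Submodule.Quotient.mk_eq_zero _).2 (Submodule.subset_span (Finset.mem_image_of_mem ρ hx))
  rw [LinearMap.comp_apply, h1, h2, map_zero, sub_zero, hi x hx]

/-- Compact Hausdorff topological modules are pure injective. -/
lemma isPureInjective_of_compactSpace (E : Type u) [AddCommGroup E] [Module R E]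
    [TopologicalSpace E] [CompactSpace E] [T2Space E] [ContinuousAdd E]
    [ContinuousConstSMul R E] : IsPureInjective R E := by
  classical
  intro M N _ _ _ _ h hh f
  -- Linear extensions of `f` are the points of the compact space E^N satisfying all these closed
  -- conditions.
  let Z : (N × N) ⊕ (R × N) ⊕ M → Set (N → E) :=
    Sum.elim (fun x ↦ {g | g (x.1 + x.2) = g x.1 + g x.2}) <|
      Sum.elim (fun x ↦ {g | g (x.1 • x.2) = x.1 • g x.2}) fun m ↦ {g | g (h m) = f m}
  have hZ (i) : IsClosed (Z i) := by
    rcases i with x | x | m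
    · exact isClosed_eq (by fun_prop) (by fun_prop)
    · exact isClosed_eq (by fun_prop) ((continuous_apply _).const_smul _)
    · exact isClosed_eq (by fun_prop) (by fun_prop)
  have hfin (I : Finset ((N × N) ⊕ (R × N) ⊕ M)) : (Set.univ ∩ ⋂ i ∈ I, Z i).Nonempty := by
    -- Condition `i` asks that the element `w i` of the free module on N be sent to `f (τ i)`. A
    -- local retraction `d` followed by `f` does this for finitely many `i`.
    let w : (N × N) ⊕ (R × N) ⊕ M → (N →₀ R) :=
      Sum.elim (fun x ↦ .single (x.1 + x.2) 1 - (.single x.1 1 + .single x.2 1)) <|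
        Sum.elim (fun x ↦ .single (x.1 • x.2) 1 - x.1 • .single x.2 1) fun m ↦ .single (h m) 1
    let τ : (N × N) ⊕ (R × N) ⊕ M → M := Sum.elim (fun _ ↦ 0) <| Sum.elim (fun _ ↦ 0) id
    let c : (N →₀ R) →ₗ[R] N := Finsupp.linearCombination R id
    have hw (i) : h (τ i) = c (w i) := by
      rcases i with x | x | m <;> simp [τ, w, c]
    obtain ⟨d, hd⟩ := hh.exists_local_retraction c (I.image w) (fun x hx ↦ by
      obtain ⟨i, -, rfl⟩ := Finset.mem_image.1 hx
      exact ⟨τ i, hw i⟩)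
    have hdw (i) (hi : i ∈ I) : d (w i) = τ i :=
      hh.1 ((hd _ (Finset.mem_image_of_mem w hi)).trans (hw i).symm)
    refine ⟨fun a ↦ f (d (.single a 1)), trivial, Set.mem_iInter₂.2 fun i hi ↦ ?_⟩
    have := hdw i hi
    rcases i with x | x | m
    · change f _ = f _ + f _
      rw [← map_add, ← map_add]
      exact congrArg f (sub_eq_zero.1 ((map_sub d _ _).symm.trans this))
    · change f _ = x.1 • f _
      rw [← map_smul, ← map_smul]
      exact congrArg f (sub_eq_zero.1 ((map_sub d _ _).symm.trans this))
    · exact congrArg f this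
  obtain ⟨g, -, hg⟩ := isCompact_univ.inter_iInter_nonempty Z hZ hfin
  rw [Set.mem_iInter] at hg
  exact ⟨{ toFun := g
           map_add' a b := hg (.inl (a, b))
           map_smul' r a := hg (.inr (.inl (r, a))) },
    LinearMap.ext fun m ↦ hg (.inr (.inr m))⟩

lemma IsPureInjective.of_retract {E P : Type u} [AddCommGroup E] [Module R E] [AddCommGroup P]
    [Module R P] (hE : IsPureInjective R E) (i : P →ₗ[R] E) (r : E →ₗ[R] P)
    (h : r ∘ₗ i = LinearMap.id) : IsPureInjective R P := by
  intro M N _ _ _ _ k hk f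
  obtain ⟨g, hg⟩ := hE M N k hk (i ∘ₗ f)
  exact ⟨r ∘ₗ g, by rw [LinearMap.comp_assoc, hg, ← LinearMap.comp_assoc, h, LinearMap.id_comp]⟩

/-- P is the pullback of E and P/F over E/F, so `f` and a lift to E of its image in E/F glue to a
map Q → P. -/
lemma IsPureMono.of_comp {F P E : Type u} [AddCommGroup F] [Module R F] [AddCommGroup P]
    [Module R P] [AddCommGroup E] [Module R E] {φ : F →ₗ[R] P} {g : P →ₗ[R] E}
    (h : IsPureMono (g ∘ₗ φ)) : IsPureMono φ := by
  refine ⟨Function.Injective.of_comp (f := g) h.1, fun Q _ _ hQ f ↦ ?_⟩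
  let gbar : (P ⧸ LinearMap.range φ) →ₗ[R] (E ⧸ LinearMap.range (g ∘ₗ φ)) :=
    Submodule.mapQ _ _ g (by
      rintro _ ⟨m, rfl⟩
      exact ⟨m, rfl⟩)
  obtain ⟨t, ht⟩ := h.2 Q hQ (gbar ∘ₗ f)
  let k : P →ₗ[R] E × (P ⧸ LinearMap.range φ) := g.prod (LinearMap.range φ).mkQ
  have hk : Function.Injective k := by
    refine (injective_iff_map_eq_zero k).2 fun p hp ↦ ?_
    obtain ⟨h1, h2⟩ := Prod.ext_iff.1 hp
    obtain ⟨m, rfl⟩ := (Submodule.Quotient.mk_eq_zero _).1 h2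
    have : m = 0 := h.1 (h1.trans (map_zero (g ∘ₗ φ)).symm)
    rw [this, map_zero]
  have hrange (q : Q) : (t.prod f) q ∈ LinearMap.range k := by
    obtain ⟨p, hp⟩ := (LinearMap.range φ).mkQ_surjective (f q)
    have hq : (LinearMap.range (g ∘ₗ φ)).mkQ (t q) = (LinearMap.range (g ∘ₗ φ)).mkQ (g p) := by
      rw [← LinearMap.comp_apply, ht, LinearMap.comp_apply, ← hp]
      rfl
    obtain ⟨m, hm⟩ := (Submodule.Quotient.eq _).1 hq
    refine ⟨p + φ m, Prod.ext ?_ ?_⟩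
    · change g (p + φ m) = t q
      rw [map_add, ← LinearMap.comp_apply, hm, add_sub_cancel]
    · change (LinearMap.range φ).mkQ (p + φ m) = f q
      rw [map_add, hp]
      simp
  refine ⟨(LinearEquiv.ofInjective k hk).symm.toLinearMap ∘ₗ (t.prod f).codRestrict _ hrange,
    LinearMap.ext fun q ↦ ?_⟩
  exact congrArg (fun x ↦ x.1.2) ((LinearEquiv.ofInjective k hk).apply_symm_apply
    ⟨(t.prod f) q, hrange q⟩)

lemma CircleBidual.isPureMono_eval (M : Type u) [AddCommGroup M] [Module R M] :
    IsPureMono (CircleBidual.eval R M) := by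
  refine isPureMono_of_exists_solution _ ?_ fun n k a m c h ↦
    CircleBidual.exists_solution M a m c h
  refine (injective_iff_map_eq_zero _).2 fun m hm ↦ ?_
  by_contra hne
  obtain ⟨χ, hχ⟩ := exists_circle_character_ne_zero hne
  exact hχ (DFunLike.congr_fun hm χ)

end Purity

/-! ### Existence of the envelope from a minimal idempotent -/

section Envelope

/-- A compact monoid in which right multiplications are continuous has an idempotent which lies
in a minimal left ideal. -/
lemma exists_minimal_idempotent {M : Type*} [Monoid M] [TopologicalSpace M] [T2Space M]
    (hmul : ∀ r : M, Continuous (· * r)) (S : Submonoid M) (hS : IsCompact (S : Set M)) :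
    ∃ e ∈ S, e * e = e ∧ ∀ s ∈ S, ∃ t ∈ S, t * (s * e) = e := by
  let A : Set (Set M) :=
    {L | IsClosed L ∧ L.Nonempty ∧ L ⊆ S ∧ ∀ s ∈ S, ∀ l ∈ L, s * l ∈ L}
  obtain ⟨L, -, hL⟩ : ∃ L ⊆ (S : Set M), Minimal (· ∈ A) L := by
    refine zorn_superset_nonempty A (fun c hcA hc hne ↦ ?_) S
      ⟨hS.isClosed, ⟨1, S.one_mem⟩, subset_rfl, fun s hs l hl ↦ S.mul_mem hs hl⟩
    refine ⟨⋂₀ c, ⟨isClosed_sInter fun t ht ↦ (hcA ht).1, ?_, ?_, ?_⟩,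
      fun s hs ↦ Set.sInter_subset_of_mem hs⟩
    · have := hne.to_subtype
      rw [Set.sInter_eq_iInter]
      exact IsCompact.nonempty_iInter_of_directed_nonempty_isCompact_isClosed _
        (DirectedOn.directed_val (IsChain.directedOn hc.symm)) (fun i ↦ (hcA i.2).2.1)
        (fun i ↦ hS.of_isClosed_subset (hcA i.2).1 (hcA i.2).2.2.1) (fun i ↦ (hcA i.2).1)
    · obtain ⟨t, ht⟩ := hne
      exact (Set.sInter_subset_of_mem ht).trans (hcA ht).2.2.1
    · exact fun s hs l hl t ht ↦ (hcA ht).2.2.2 s hs l (hl t ht)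
  obtain ⟨hcl, hne, hLS, hideal⟩ := hL.prop
  obtain ⟨e, he, hee⟩ := exists_idempotent_in_compact_subsemigroup hmul L hne
    (hS.of_isClosed_subset hcl hLS) fun x hx y hy ↦ hideal x (hLS hx) y hy
  refine ⟨e, hLS he, hee, fun s hs ↦ ?_⟩
  -- The closed left ideal S·(s·e) lies in the minimal ideal L, so it equals L and contains `e`.
  have hsub : (· * (s * e)) '' (S : Set M) ⊆ L := by
    rintro _ ⟨t, ht, rfl⟩
    exact hideal t ht _ (hideal s hs e he)
  have hmem : (· * (s * e)) '' (S : Set M) ∈ A :=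
    ⟨(hS.image (hmul _)).isClosed, ⟨_, 1, S.one_mem, rfl⟩, hsub.trans hLS, by
      rintro t ht _ ⟨t', ht', rfl⟩
      exact ⟨t * t', S.mul_mem ht ht', mul_assoc _ _ _⟩⟩
  obtain ⟨t, ht, hte⟩ := hL.le_of_le hmem hsub he
  exact ⟨t, ht, hte⟩

variable {R : Type u} [Ring R]

/-- A pure submodule of a compact Hausdorff topological module has a pure injective envelope. -/
lemma exists_isPureInjectiveEnvelope_of_compactSpace {F E : Type u} [AddCommGroup F] [Module R F]
    [AddCommGroup E] [Module R E] [TopologicalSpace E] [CompactSpace E] [T2Space E]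
    [ContinuousAdd E] [ContinuousConstSMul R E] (j : F →ₗ[R] E) (hj : IsPureMono j) :
    ∃ (P : ModuleCat.{u} R) (φ : F →ₗ[R] P), IsPureInjectiveEnvelope φ := by
  have hE : IsPureInjective R E := isPureInjective_of_compactSpace E
  let _ : TopologicalSpace (Function.End E) := inferInstanceAs (TopologicalSpace (E → E))
  have _ : T2Space (Function.End E) := inferInstanceAs (T2Space (E → E))
  have _ : CompactSpace (Function.End E) := inferInstanceAs (CompactSpace (E → E))
  have hev (x : E) : Continuous fun f : Function.End E ↦ f x := continuous_apply x
  have hmul (r : Function.End E) : Continuous fun f : Function.End E ↦ f * r :=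
    continuous_pi_iff.2 fun x ↦ hev (r x)
  let S : Submonoid (Function.End E) :=
    { carrier := {f | ∃ g : E →ₗ[R] E, g ∘ₗ j = j ∧ ⇑g = f}
      one_mem' := ⟨LinearMap.id, rfl, rfl⟩
      mul_mem' := by
        rintro _ _ ⟨g, hg, rfl⟩ ⟨g', hg', rfl⟩
        exact ⟨g ∘ₗ g', by rw [LinearMap.comp_assoc, hg', hg], rfl⟩ }
  have hS : IsCompact (S : Set (Function.End E)) := by
    have : (S : Set (Function.End E)) =
        (⋂ (a : E) (b : E), {f | f (a + b) = f a + f b}) ∩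
        ((⋂ (r : R) (a : E), {f | f (r • a) = r • f a}) ∩ ⋂ m : F, {f | f (j m) = j m}) := by
      ext f
      simp only [Set.mem_inter_iff, Set.mem_iInter]
      constructor
      · rintro ⟨g, hg, rfl⟩
        exact ⟨map_add g, map_smul g, LinearMap.congr_fun hg⟩
      · rintro ⟨h1, h2, h3⟩
        exact ⟨{ toFun := f, map_add' := h1, map_smul' := h2 }, LinearMap.ext h3, rfl⟩
    rw [this]
    refine IsClosed.isCompact (.inter ?_ (.inter ?_ ?_))
    · exact isClosed_iInter fun a ↦ isClosed_iInter fun b ↦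
        isClosed_eq (hev _) ((hev _).add (hev _))
    · exact isClosed_iInter fun r ↦ isClosed_iInter fun a ↦
        isClosed_eq (hev _) ((hev _).const_smul _)
    · exact isClosed_iInter fun m ↦ isClosed_eq (hev _) continuous_const
  obtain ⟨_, ⟨e, hej, rfl⟩, hee, hmin⟩ := exists_minimal_idempotent hmul S hS
  have hee' (x : E) : e (e x) = e x := congrFun hee x
  have hej' (m : F) : e (j m) = j m := LinearMap.congr_fun hej m
  let P := LinearMap.range e
  let φ : F →ₗ[R] P := e.rangeRestrict ∘ₗ j
  have hφ (m : F) : (φ m : E) = j m := hej' m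
  have hP (x : P) : e x = x := by
    obtain ⟨_, y, rfl⟩ := x
    exact hee' y
  -- Minimality of `e` gives each endomorphism of P fixing F a left inverse that also fixes F. A
  -- monoid with left inverses is a group, whence bijectivity.
  have hinv (f : P →ₗ[R] P) (hf : f ∘ₗ φ = φ) :
      ∃ k : P →ₗ[R] P, k ∘ₗ φ = φ ∧ ∀ x, k (f x) = x := by
    obtain ⟨_, ⟨t, htj, rfl⟩, ht⟩ := hmin _
      ⟨P.subtype ∘ₗ f ∘ₗ e.rangeRestrict, LinearMap.ext fun m ↦
        (congrArg Subtype.val (LinearMap.congr_fun hf m)).trans (hφ m), rfl⟩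
    refine ⟨e.rangeRestrict ∘ₗ t ∘ₗ P.subtype, LinearMap.ext fun m ↦ Subtype.ext ?_,
      fun x ↦ Subtype.ext ?_⟩
    · change e (t (φ m)) = φ m
      rw [hφ, ← LinearMap.comp_apply t, htj, hej']
    · have h1 : t (f (e.rangeRestrict (e x))) = e x := congrFun ht x
      have h2 : e.rangeRestrict (e x) = x := Subtype.ext ((hee' x).trans (hP x))
      rw [h2, hP] at h1
      change e (t (f x)) = x
      rw [h1, hP]
  refine ⟨ModuleCat.of R P, φ, ?_, ?_, ?_⟩
  · exact hE.of_retract P.subtype e.rangeRestrict (LinearMap.ext fun x ↦ Subtype.ext (hP x))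
  · intro X _ _ hX f
    obtain ⟨g, hg⟩ := hX F E j hj f
    refine ⟨g ∘ₗ P.subtype, LinearMap.ext fun m ↦ ?_⟩
    rw [← hg]
    exact congrArg g (hφ m)
  · intro f hf
    obtain ⟨k, hk, hkf⟩ := hinv f hf
    obtain ⟨l, -, hlk⟩ := hinv k hk
    exact ⟨Function.LeftInverse.injective hkf, fun y ↦ ⟨k y, by
      have hkinj := Function.LeftInverse.injective hlk
      exact hkinj (hkf (k y))⟩⟩

end Envelope

/-! ### Closure properties of lim→ B -/

section Closure

variable {R : Type u} [Ring R] {B : ObjectProperty (ModuleCat.{u} R)}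

lemma limB_circleBidual (hfp : ∀ M : ModuleCat.{u} R, B M → Module.FinitePresentation R M)
    (hcoh : IsBCoherent B) (F : ModuleCat.{u} R) (hF : LimB B F) :
    LimB B (ModuleCat.of R (CircleBidual F)) := by
  rw [limB_iff hfp]
  intro Q _ _ hQ f
  -- The product is indexed by all maps Q → F, so a single `q` serves them all: each extends along
  -- `q` by a coordinate of `v`.
  obtain ⟨W, q, v, hW, hv⟩ := (limB_iff hfp _).1 (hcoh (Q →ₗ[R] F) (fun _ ↦ F) fun _ ↦ hF) Q hQ
    (LinearMap.pi fun g ↦ g)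
  obtain ⟨y, hy⟩ := CircleBidual.exists_extension F q
    (fun g ↦ ⟨LinearMap.proj g ∘ₗ v, by rw [LinearMap.comp_assoc, hv]; rfl⟩) f
  exact ⟨W, q, y, hW, hy⟩

lemma LimB.of_retract (hfp : ∀ M : ModuleCat.{u} R, B M → Module.FinitePresentation R M)
    {M N : ModuleCat.{u} R} (hM : LimB B M) (i : N →ₗ[R] M) (r : M →ₗ[R] N)
    (h : r ∘ₗ i = LinearMap.id) : LimB B N := by
  rw [limB_iff hfp] at hM ⊢
  intro Q _ _ hQ f
  obtain ⟨W, p, v, hW, hv⟩ := hM Q hQ (i ∘ₗ f)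
  exact ⟨W, p, r ∘ₗ v, hW, by
    rw [LinearMap.comp_assoc, hv, ← LinearMap.comp_assoc, h, LinearMap.id_comp]⟩

lemma LimB.of_pure_quotient (hfp : ∀ M : ModuleCat.{u} R, B M → Module.FinitePresentation R M)
    {M : Type u} [AddCommGroup M] [Module R M] {N : ModuleCat.{u} R} (hN : LimB B N)
    {h : M →ₗ[R] N} (hh : IsPureMono h) : LimB B (ModuleCat.of R (N ⧸ LinearMap.range h)) := by
  rw [limB_iff hfp] at hN ⊢
  intro Q _ _ hQ f
  obtain ⟨f', hf'⟩ := hh.2 Q hQ f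
  obtain ⟨W, p, v, hW, hv⟩ := hN Q hQ f'
  exact ⟨W, p, (LinearMap.range h).mkQ ∘ₗ v, hW, by rw [LinearMap.comp_assoc, hv, hf']⟩

end Closure

theorem mainTheorem7 (R : Type u) [Ring R]
    (B : CategoryTheory.ObjectProperty (ModuleCat.{u} R))
    (hfp : ∀ M : ModuleCat.{u} R, B M → Module.FinitePresentation R M)
    (hadd : CategoryTheory.Limits.HasFiniteBiproducts B.FullSubcategory)
    (hR : LimB B (ModuleCat.of R R))
    (hcoh : IsBCoherent B)
    (F : ModuleCat.{u} R) (hF : LimB B F) :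
    (∃ (P : ModuleCat.{u} R) (φ : F →ₗ[R] P), IsPureInjectiveEnvelope φ) ∧
      ∀ (P : ModuleCat.{u} R) (φ : F →ₗ[R] P), IsPureInjectiveEnvelope φ →
        Function.Injective φ ∧ LimB B P ∧
          LimB B (ModuleCat.of R (P ⧸ LinearMap.range φ)) := by
  have hj : IsPureMono (CircleBidual.eval R F) := CircleBidual.isPureMono_eval F
  refine ⟨exists_isPureInjectiveEnvelope_of_compactSpace _ hj, fun P φ hφ ↦ ?_⟩
  obtain ⟨g, hg⟩ := hφ.preenvelope (CircleBidual F) (isPureInjective_of_compactSpace _)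
    (CircleBidual.eval R F)
  have hpure : IsPureMono φ := IsPureMono.of_comp (g := g) (hg ▸ hj)
  obtain ⟨k, hk⟩ := hφ.pureInjective F (CircleBidual F) _ hj φ
  -- P → F** → P fixes F, hence is an automorphism, making P a retract of F**.
  have hbij := hφ.minimal (k ∘ₗ g) (by rw [LinearMap.comp_assoc, hg, hk])
  let e := LinearEquiv.ofBijective (k ∘ₗ g) hbij
  have hP : LimB B P := LimB.of_retract hfp (limB_circleBidual hfp hcoh F hF) g
    (e.symm.toLinearMap ∘ₗ k) (LinearMap.ext fun x ↦ e.symm_apply_apply x)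
  exact ⟨hpure.1, hP, hP.of_pure_quotient hfp hpure⟩
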